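/- Let $R$ be an associative ring with $1$ (not necessarily commutative), let $\mathcal{Q}$ be a class of left $R$-modules, and let $M$ be a right $R$-module. A right $R$-module $N$ is called $\mathcal{Q}$-Mittag--Leffler if for every family $(Q_i)_{i\in I}$ of modules from $\mathcal{Q}$ the canonical map $N\otimes_R\prod_{i\in I}Q_i\to\prod_{i\in I}(N\otimes_R Q_i)$ is injective. An $\aleph_1$-dense system in $M$ is a set $\mathcal{C}$ of submodules of $M$, directed under inclusion, which is closed under unions of nonempty well-ordered ascending chains of countable length and such that every countable subset of $M$ is contained in some element of $\mathcal{C}$. The following statements are equivalent: (i) $M$ is $\mathcal{Q}$-Mittag--Leffler. (ii) For every countable subset $X$ of $M$ there is a countably generated $\mathcal{Q}$-Mittag--Leffler submodule $N$ of $M$ containing $X$ such that, with $\varepsilon\colon N\to M$ the inclusion, $\varepsilon\otimes_R Q\colon N\otimes_R Q\to M\otimes_R Q$ is injective for all $Q\in\mathcal{Q}$. (iii) $M$ has an $\aleph_1$-dense system consisting of countably generated $\mathcal{Q}$-Mittag--Leffler modules. (iv) $M$ has an $\aleph_1$-dense system consisting of $\mathcal{Q}$-Mittag--Leffler modules. If,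 in addition, $R\in\mathcal{Q}$, then these statements are further equivalent to (v) $M$ has an $\aleph_1$-dense system consisting of countably presented $\mathcal{Q}$-Mittag--Leffler modules. -/

import Mathlib

open scoped TensorProduct Cardinal

universe u v w

namespace RelML

noncomputable section

section Tensor

variable (R : Type u) [Ring R] (M : Type v) [AddCommGroup M] [Module Rᵐᵒᵖ M]
  (Q : Type w) [AddCommGroup Q] [Module R Q]

/-- The subgroup of `M ⊗_ℤ Q` generated by all `(m r) ⊗ q - m ⊗ (r q)`. A right `R`-module is a
module over `Rᵐᵒᵖ`, so `m r` is written `MulOpposite.op r • m`. -/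
def balancingRelations : AddSubgroup (M ⊗[ℤ] Q) :=
  AddSubgroup.closure
    {t | ∃ (m : M) (r : R) (q : Q), t = (MulOpposite.op r • m) ⊗ₜ[ℤ] q - m ⊗ₜ[ℤ] (r • q)}

/-- The tensor product `M ⊗_R Q` of a right module `M` and a left module `Q` over a ring `R` that
need not be commutative; it is an abelian group. -/
abbrev BalTensor : Type (max v w) := (M ⊗[ℤ] Q) ⧸ balancingRelations R M Q

variable {M Q}

/-- The pure tensor `m ⊗ q` in `M ⊗_R Q`. -/
def BalTensor.tmul (m : M) (q : Q) : BalTensor R M Q :=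
  QuotientAddGroup.mk (m ⊗ₜ[ℤ] q)

theorem BalTensor.smul_tmul (m : M) (r : R) (q : Q) :
    BalTensor.tmul R (MulOpposite.op r • m) q = BalTensor.tmul R m (r • q) :=
  QuotientAddGroup.eq_iff_sub_mem.2 (AddSubgroup.subset_closure ⟨m, r, q, rfl⟩)

end Tensor

section Map

variable {R : Type u} [Ring R] {M M' : Type v} [AddCommGroup M] [Module Rᵐᵒᵖ M]
  [AddCommGroup M'] [Module Rᵐᵒᵖ M'] {Q Q' : Type*} [AddCommGroup Q] [Module R Q]
  [AddCommGroup Q'] [Module R Q']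

theorem balancingRelations_le_comap (f : M →ₗ[Rᵐᵒᵖ] M') (g : Q →ₗ[R] Q') :
    balancingRelations R M Q ≤ (balancingRelations R M' Q').comap
      (TensorProduct.map f.toAddMonoidHom.toIntLinearMap g.toAddMonoidHom.toIntLinearMap).toAddMonoidHom := by
  refine (AddSubgroup.closure_le _).2 ?_
  rintro _ ⟨m, r, q, rfl⟩
  refine AddSubgroup.subset_closure ⟨f m, r, g q, ?_⟩
  simp

/-- The homomorphism `f ⊗_R g`, which sends `m ⊗ q` to `f m ⊗ g q`. -/
def BalTensor.map (f : M →ₗ[Rᵐᵒᵖ] M') (g : Q →ₗ[R] Q') :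
    BalTensor R M Q →+ BalTensor R M' Q' :=
  QuotientAddGroup.map _ _
    (TensorProduct.map f.toAddMonoidHom.toIntLinearMap g.toAddMonoidHom.toIntLinearMap).toAddMonoidHom
    (balancingRelations_le_comap f g)

theorem BalTensor.map_tmul (f : M →ₗ[Rᵐᵒᵖ] M') (g : Q →ₗ[R] Q') (m : M) (q : Q) :
    BalTensor.map f g (BalTensor.tmul R m q) = BalTensor.tmul R (f m) (g q) :=
  rfl

end Map

section MittagLeffler

variable {R : Type u} [Ring R]

/-- The canonical homomorphism `ρ : M ⊗_R ∏ i, F i → ∏ i, M ⊗_R F i`, which sends `m ⊗ (q i)_i` to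
`(m ⊗ q i)_i`. -/
def rho (M : Type u) [AddCommGroup M] [Module Rᵐᵒᵖ M] {I : Type u} (F : I → ModuleCat.{u} R) :
    BalTensor R M (∀ i, F i) →+ ∀ i, BalTensor R M (F i) :=
  AddMonoidHom.pi fun i => BalTensor.map LinearMap.id (LinearMap.proj i)

/-- The right module `M` is `𝒬`-Mittag-Leffler: `ρ` is injective for every family of modules
from `𝒬`. -/
def IsMittagLeffler (𝒬 : Set (ModuleCat.{u} R)) (M : Type u) [AddCommGroup M]
    [Module Rᵐᵒᵖ M] : Prop :=
  ∀ (I : Type u) (F : I → ModuleCat.{u} R), (∀ i, F i ∈ 𝒬) → Function.Injective (rho M F)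

end MittagLeffler

section Modules

variable (A : Type u) [Ring A] (M : Type v) [AddCommGroup M] [Module A M]

/-- `M` is generated by a countable (possibly finite) subset. -/
def CountablyGenerated : Prop :=
  ∃ S : Set M, S.Countable ∧ Submodule.span A S = ⊤

/-- `M` is the quotient of a free module of countable rank by a countably generated submodule. -/
def CountablyPresented : Prop :=
  ∃ f : (ℕ →₀ A) →ₗ[A] M, Function.Surjective f ∧ CountablyGenerated A (LinearMap.ker f)

variable {A M}

/-- `C` is a `κ`-dense system in `M`, for a regular uncountable cardinal `κ`. Nonempty well-ordered
chains of length `< κ` are indexed by nonempty well-ordered sets of cardinality `< κ`; the supremum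
of such a chain of submodules is its union. -/
structure IsDenseSystem (κ : Cardinal.{v}) (C : Set (Submodule A M)) : Prop where
  directed : DirectedOn (· ≤ ·) C
  chain_closed : ∀ (ι : Type v) [LinearOrder ι] [WellFoundedLT ι] [Nonempty ι],
    Cardinal.mk ι < κ → ∀ N : ι → Submodule A M, Monotone N → (∀ i, N i ∈ C) → (⨆ i, N i) ∈ C
  exists_le : ∀ X : Set M, Cardinal.mk X < κ → ∃ N ∈ C, X ⊆ N

end Modules

end

end RelML

/-!
A homomorphism `g` dominates `f` if `g ⊗ Q` kills the kernel of `f ⊗ Q` for all `Q ∈ 𝒬`. If `M` is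
`𝒬`-Mittag-Leffler, then every finitely generated `L ≤ M` lies in a finitely generated `L' ≤ M` such
that `L → L'` dominates `L → M`: otherwise choose for each `L'` an element `y L' ∈ L ⊗ Q L'` that
dies in `M ⊗ Q L'` but not in `L' ⊗ Q L'`. As `L` is finitely generated, the family `y` lifts to
`L ⊗ ∏ Q L'`, and the lift dies in `M ⊗ ∏ Q L'`, hence already in some `L' ⊗ ∏ Q L'`, a
contradiction. Iterating `L ↦ L'` along `ℕ` yields countably generated submodules which are pure for
`𝒬`. Since `M` is also Mittag-Leffler for the products of modules from `𝒬`, they can be taken pure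
for these products as well, and then they inherit the Mittag-Leffler property.

Conversely, let `M` have an `ℵ₁`-dense system of Mittag-Leffler submodules and let `y ∈ N₀ ⊗ ∏ Q i`
have nonzero image in `M ⊗ ∏ Q i` and zero image in every `M ⊗ Q i`. Each `N ≥ N₀` in the system has
an index `i` for which the `i`-th component of `y` is nonzero in `N ⊗ Q i` but zero in `N' ⊗ Q i`
for some larger `N'`. The union of an `ω`-chain `N₀ ≤ N₁ ≤ …` built this way is Mittag-Leffler, so a
single step of the chain kills all of these countably many components at once, which is absurd.

For `R ∈ 𝒬` and a surjection `p : A → M` from a countably generated module, right exactness and the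
injectivity of `M ⊗ R ^ K → M ^ K` confine the part of `ker p` inside a finitely generated submodule
of `A` to a finitely generated submodule of `ker p`, so that `ker p` is countably generated.
-/

namespace RelML

noncomputable section

namespace BalTensor

section Functoriality

variable {R : Type u} [Ring R] {M : Type v} [AddCommGroup M] [Module Rᵐᵒᵖ M]
  {Q : Type w} [AddCommGroup Q] [Module R Q]

/-- The pure tensor `m ⊗ q` as a biadditive function of `m` and `q`. -/
def tmulHom : M →+ Q →+ BalTensor R M Q :=
  AddMonoidHom.mk' (fun m => AddMonoidHom.mk' (fun q => tmul R m q)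
    fun q q' => by simp [tmul, TensorProduct.tmul_add])
    fun m m' => by ext q; simp [tmul, TensorProduct.add_tmul]

theorem tmulHom_apply (m : M) (q : Q) : tmulHom m q = tmul R m q :=
  rfl

theorem induction_on {p : BalTensor R M Q → Prop} (z : BalTensor R M Q) (zero : p 0)
    (tmul : ∀ m q, p (tmul R m q)) (add : ∀ x y, p x → p y → p (x + y)) : p z := by
  induction z using QuotientAddGroup.induction_on with
  | H z =>
    induction z using TensorProduct.induction_on with
    | zero => exact zero
    | tmul m q => exact tmul m q
    | add x y hx hy => exact add _ _ hx hy

/-- The homomorphism on `M ⊗_R Q` induced by a balanced biadditive map. -/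
def lift {P : Type*} [AddCommGroup P] (f : M →+ Q →+ P)
    (hf : ∀ (m : M) (r : R) (q : Q), f (MulOpposite.op r • m) q = f m (r • q)) :
    BalTensor R M Q →+ P :=
  QuotientAddGroup.lift _ (TensorProduct.liftAddHom f fun n m q => by simp) <| by
    refine (AddSubgroup.closure_le _).2 ?_
    rintro _ ⟨m, r, q, rfl⟩
    simp [hf]

theorem lift_tmul {P : Type*} [AddCommGroup P] (f : M →+ Q →+ P)
    (hf : ∀ (m : M) (r : R) (q : Q), f (MulOpposite.op r • m) q = f m (r • q)) (m : M) (q : Q) :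
    lift f hf (tmul R m q) = f m q :=
  rfl

theorem map_id (z : BalTensor R M Q) : map LinearMap.id LinearMap.id z = z := by
  induction z using induction_on with
  | zero => exact map_zero _
  | tmul m q => rfl
  | add x y hx hy => rw [map_add, hx, hy]

variable {M' M'' : Type v} [AddCommGroup M'] [Module Rᵐᵒᵖ M'] [AddCommGroup M'']
  [Module Rᵐᵒᵖ M''] {Q' Q'' : Type*} [AddCommGroup Q'] [Module R Q'] [AddCommGroup Q'']
  [Module R Q'']

theorem map_map (f' : M' →ₗ[Rᵐᵒᵖ] M'') (g' : Q' →ₗ[R] Q'') (f : M →ₗ[Rᵐᵒᵖ] M')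
    (g : Q →ₗ[R] Q') (z : BalTensor R M Q) :
    map f' g' (map f g z) = map (f' ∘ₗ f) (g' ∘ₗ g) z := by
  induction z using induction_on with
  | zero => simp only [map_zero]
  | tmul m q => rfl
  | add x y hx hy => simp only [map_add, hx, hy]

variable (Q) in
/-- The homomorphism `f ⊗_R Q`. -/
abbrev rTensor (f : M →ₗ[Rᵐᵒᵖ] M') : BalTensor R M Q →+ BalTensor R M' Q :=
  map f LinearMap.id

theorem map_equiv_injective (f : M ≃ₗ[Rᵐᵒᵖ] M') (g : Q ≃ₗ[R] Q') :
    Function.Injective (map f.toLinearMap g.toLinearMap) := by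
  refine Function.LeftInverse.injective (g := map f.symm.toLinearMap g.symm.toLinearMap)
    fun z => ?_
  rw [map_map, LinearEquiv.symm_comp, LinearEquiv.symm_comp, map_id]

/-- The homomorphism `M ⊗_R R → M`, `m ⊗ r ↦ m r`. -/
def rid : BalTensor R M R →+ M :=
  lift ((smulAddHom Rᵐᵒᵖ M).comp MulOpposite.opAddEquiv.toAddMonoidHom).flip
    fun m r s => by simp [mul_smul]

theorem rid_tmul (m : M) (r : R) : rid (tmul R m r) = MulOpposite.op r • m :=
  lift_tmul _ _ m r

theorem rid_rTensor (f : M →ₗ[Rᵐᵒᵖ] M') (z : BalTensor R M R) :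
    rid (rTensor _ f z) = f (rid z) := by
  induction z using induction_on with
  | zero => simp only [map_zero]
  | tmul m r => rw [map_tmul, rid_tmul, rid_tmul, map_smul, LinearMap.id_apply]
  | add x y hx hy => simp only [map_add, hx, hy]

theorem map_balancingRelations_of_surjective {f : M →ₗ[Rᵐᵒᵖ] M'} (hf : Function.Surjective f) :
    (balancingRelations R M Q).map (TensorProduct.map f.toAddMonoidHom.toIntLinearMap
      (LinearMap.id : Q →ₗ[ℤ] Q)).toAddMonoidHom = balancingRelations R M' Q := by
  rw [balancingRelations, AddMonoidHom.map_closure, balancingRelations]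
  congr 1
  ext t
  constructor
  · rintro ⟨_, ⟨m, r, q, rfl⟩, rfl⟩
    exact ⟨f m, r, q, by simp⟩
  · rintro ⟨m', r, q, rfl⟩
    obtain ⟨m, rfl⟩ := hf m'
    exact ⟨_, ⟨m, r, q, rfl⟩, by simp⟩

theorem exists_rTensor_ker_subtype_eq {f : M →ₗ[Rᵐᵒᵖ] M'} (hf : Function.Surjective f)
    {z : BalTensor R M Q} (hz : rTensor Q f z = 0) :
    ∃ y : BalTensor R (LinearMap.ker f) Q, rTensor _ (LinearMap.ker f).subtype y = z := by
  obtain ⟨z, rfl⟩ := QuotientAddGroup.mk_surjective z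
  let fQ := LinearMap.rTensor Q f.toAddMonoidHom.toIntLinearMap
  let kerQ := LinearMap.rTensor Q (LinearMap.ker f).subtype.toAddMonoidHom.toIntLinearMap
  have hz : fQ z ∈ balancingRelations R M' Q := (QuotientAddGroup.eq_zero_iff _).1 hz
  rw [← map_balancingRelations_of_surjective hf] at hz
  obtain ⟨b, hb, hbz⟩ := hz
  have hexact : Function.Exact kerQ fQ :=
    rTensor_exact Q (f := (LinearMap.ker f).subtype.toAddMonoidHom.toIntLinearMap)
      (g := f.toAddMonoidHom.toIntLinearMap) (LinearMap.exact_subtype_ker_map f) hf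
  obtain ⟨y, hy⟩ := (hexact (z - b)).1 <| by rw [map_sub, sub_eq_zero]; exact hbz.symm
  refine ⟨QuotientAddGroup.mk y, QuotientAddGroup.eq_iff_sub_mem.2 ?_⟩
  have hyz : kerQ y - z = -b := by rw [hy, sub_sub_cancel_left]
  exact hyz ▸ neg_mem hb

end Functoriality

section DirectedUnion

variable {R : Type u} [Ring R] {M : Type v} [AddCommGroup M] [Module Rᵐᵒᵖ M]
  {Q : Type w} [AddCommGroup Q] [Module R Q] {ι : Type*} [Preorder ι] [IsDirectedOrder ι]
  {N : ι → Submodule Rᵐᵒᵖ M}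

theorem rTensor_inclusion_inclusion {N₁ N₂ N₃ : Submodule Rᵐᵒᵖ M} (h₁₂ : N₁ ≤ N₂)
    (h₂₃ : N₂ ≤ N₃) (z : BalTensor R N₁ Q) :
    rTensor Q (Submodule.inclusion h₂₃) (rTensor _ (Submodule.inclusion h₁₂) z) =
      rTensor _ (Submodule.inclusion (h₁₂.trans h₂₃)) z :=
  map_map _ _ _ _ z

theorem rTensor_subtype_inclusion {N₁ N₂ : Submodule Rᵐᵒᵖ M} (h : N₁ ≤ N₂)
    (z : BalTensor R N₁ Q) :
    rTensor Q N₂.subtype (rTensor _ (Submodule.inclusion h) z) = rTensor _ N₁.subtype z :=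
  map_map _ _ _ _ z

theorem exists_rTensor_inclusion_eq [Nonempty ι] (hN : Monotone N)
    (z : BalTensor R (⨆ i, N i : Submodule Rᵐᵒᵖ M) Q) :
    ∃ (i : ι) (y : BalTensor R (N i) Q),
      rTensor _ (Submodule.inclusion (le_iSup N i)) y = z := by
  induction z using induction_on with
  | zero => exact ⟨Classical.arbitrary ι, 0, map_zero _⟩
  | tmul m q =>
    obtain ⟨i, hi⟩ := (Submodule.mem_iSup_of_directed N hN.directed_le).1 m.2
    exact ⟨i, tmul R ⟨m, hi⟩ q, rfl⟩
  | add x y hx hy =>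
    obtain ⟨i, x, rfl⟩ := hx
    obtain ⟨j, y, rfl⟩ := hy
    obtain ⟨k, hik, hjk⟩ := exists_ge_ge i j
    refine ⟨k, rTensor _ (Submodule.inclusion (hN hik)) x +
      rTensor _ (Submodule.inclusion (hN hjk)) y, ?_⟩
    rw [map_add, rTensor_inclusion_inclusion, rTensor_inclusion_inclusion]

section Lift

variable [Nonempty ι] {P : Type*} [AddCommGroup P] (hN : Monotone N)
  (c : ∀ i, BalTensor R (N i) Q →+ P)

/-- The map `q ↦ c i (u ⊗ q)`, for homomorphisms `c i` out of the `N i ⊗_R Q` and an element `u` of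
the union of the `N i`, computed at some index `i` with `u ∈ N i`. -/
def iSupTmul (u : (⨆ i, N i : Submodule Rᵐᵒᵖ M)) : Q →+ P :=
  (c _).comp <| tmulHom
    ⟨(u : M), ((Submodule.mem_iSup_of_directed N hN.directed_le).1 u.2).choose_spec⟩

variable {c} (hc : ∀ i j (hij : i ≤ j) (z : BalTensor R (N i) Q),
  c j (rTensor _ (Submodule.inclusion (hN hij)) z) = c i z)

include hc in
theorem iSupTmul_eq {u : (⨆ i, N i : Submodule Rᵐᵒᵖ M)} {i : ι} (hu : (u : M) ∈ N i) :
    iSupTmul hN c u = (c i).comp (tmulHom ⟨(u : M), hu⟩) := by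
  have hspec := ((Submodule.mem_iSup_of_directed N hN.directed_le).1 u.2).choose_spec
  obtain ⟨k, hjk, hik⟩ := exists_ge_ge (Exists.choose _) i
  ext q
  exact (hc _ k hjk (tmul R ⟨(u : M), hspec⟩ q)).symm.trans
    (hc i k hik (tmul R ⟨(u : M), hu⟩ q))

include hc in
theorem iSupTmul_add (u u' : (⨆ i, N i : Submodule Rᵐᵒᵖ M)) :
    iSupTmul hN c (u + u') = iSupTmul hN c u + iSupTmul hN c u' := by
  obtain ⟨i, hi⟩ := (Submodule.mem_iSup_of_directed N hN.directed_le).1 u.2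
  obtain ⟨j, hj⟩ := (Submodule.mem_iSup_of_directed N hN.directed_le).1 u'.2
  obtain ⟨k, hik, hjk⟩ := exists_ge_ge i j
  have hu := hN hik hi
  have hu' := hN hjk hj
  rw [iSupTmul_eq hN hc hu, iSupTmul_eq hN hc hu',
    iSupTmul_eq hN hc (u := u + u') (add_mem hu hu'), ← AddMonoidHom.comp_add, ← map_add]
  rfl

include hc in
theorem iSupTmul_smul (u : (⨆ i, N i : Submodule Rᵐᵒᵖ M)) (r : R) (q : Q) :
    iSupTmul hN c (MulOpposite.op r • u) q = iSupTmul hN c u (r • q) := by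
  obtain ⟨i, hi⟩ := (Submodule.mem_iSup_of_directed N hN.directed_le).1 u.2
  rw [iSupTmul_eq hN hc hi,
    iSupTmul_eq hN hc (u := MulOpposite.op r • u) (Submodule.smul_mem _ _ hi)]
  exact congrArg (c i) (smul_tmul R (⟨(u : M), hi⟩ : N i) r q)

/-- The homomorphism out of `(⨆ i, N i) ⊗_R Q` glued from compatible homomorphisms out of the
`N i ⊗_R Q`. -/
def iSupLift : BalTensor R (⨆ i, N i : Submodule Rᵐᵒᵖ M) Q →+ P :=
  lift (AddMonoidHom.mk' (iSupTmul hN c) (iSupTmul_add hN hc)) (iSupTmul_smul hN hc)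

theorem iSupLift_rTensor_inclusion {i : ι} (z : BalTensor R (N i) Q) :
    iSupLift hN hc (rTensor _ (Submodule.inclusion (le_iSup N i)) z) = c i z := by
  induction z using induction_on with
  | zero => simp only [map_zero]
  | tmul m q => exact DFunLike.congr_fun (iSupTmul_eq hN hc m.2) q
  | add x y hx hy => simp only [map_add, hx, hy]

end Lift

theorem exists_rTensor_inclusion_eq_zero (hN : Monotone N) {i : ι} {z : BalTensor R (N i) Q}
    (hz : rTensor Q (Submodule.inclusion (le_iSup N i)) z = 0) :
    ∃ (j : ι) (hij : i ≤ j), rTensor Q (Submodule.inclusion (hN hij)) z = 0 := by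
  classical
  have : Nonempty ι := ⟨i⟩
  let transition (j k : ι) (hjk : j ≤ k) : BalTensor R (N j) Q →+ BalTensor R (N k) Q :=
    rTensor _ (Submodule.inclusion (hN hjk))
  have : DirectedSystem (fun j => BalTensor R (N j) Q) fun j k hjk => transition j k hjk :=
    { map_self := fun _ z => map_id z
      map_map := fun _ _ _ hij hjk z => rTensor_inclusion_inclusion (hN hij) (hN hjk) z }
  refine AddCommGroup.DirectLimit.of.zero_exact (f := transition) i z ?_
  have hcompat (j k : ι) (hjk : j ≤ k) (y : BalTensor R (N j) Q) :
      AddCommGroup.DirectLimit.of _ transition k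
          (rTensor _ (Submodule.inclusion (hN hjk)) y) =
        AddCommGroup.DirectLimit.of _ transition j y :=
    AddCommGroup.DirectLimit.of_f (f := transition) hjk y
  rw [← iSupLift_rTensor_inclusion hN hcompat, hz, map_zero]

theorem exists_rTensor_subtype_eq [Nonempty ι] (hN : Monotone N) (hsup : ⨆ i, N i = ⊤)
    (z : BalTensor R M Q) :
    ∃ (i : ι) (y : BalTensor R (N i) Q), rTensor _ (N i).subtype y = z := by
  have htop (m : M) : m ∈ ⨆ i, N i := hsup ▸ Submodule.mem_top
  obtain ⟨i, y, hy⟩ := exists_rTensor_inclusion_eq hN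
    (rTensor _ (LinearMap.id.codRestrict _ htop) z)
  refine ⟨i, y, ?_⟩
  rw [← rTensor_subtype_inclusion (le_iSup N i), hy, map_map]
  exact map_id z

theorem exists_rTensor_inclusion_eq_zero_of_rTensor_subtype_eq_zero (hN : Monotone N)
    (hsup : ⨆ i, N i = ⊤) {i : ι} {z : BalTensor R (N i) Q}
    (hz : rTensor Q (N i).subtype z = 0) :
    ∃ (j : ι) (hij : i ≤ j), rTensor Q (Submodule.inclusion (hN hij)) z = 0 := by
  have htop (m : M) : m ∈ ⨆ i, N i := hsup ▸ Submodule.mem_top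
  refine exists_rTensor_inclusion_eq_zero hN ?_
  rw [← map_zero (rTensor _ (LinearMap.id.codRestrict _ htop)), ← hz, map_map]
  rfl

end DirectedUnion

end BalTensor

section Rho

variable {R : Type u} [Ring R]

theorem BalTensor.exists_sum_tmul_eq {M : Type v} [AddCommGroup M] [Module Rᵐᵒᵖ M] {Q : Type w}
    [AddCommGroup Q] [Module R Q] {σ : Type*} [Fintype σ] {s : σ → M}
    (hs : Submodule.span Rᵐᵒᵖ (Set.range s) = ⊤) (z : BalTensor R M Q) :
    ∃ q : σ → Q, ∑ a, BalTensor.tmul R (s a) (q a) = z := by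
  simp only [← BalTensor.tmulHom_apply]
  induction z using BalTensor.induction_on with
  | zero => exact ⟨0, by simp only [Pi.zero_apply, map_zero, Finset.sum_const_zero]⟩
  | tmul m q =>
    obtain ⟨c, rfl⟩ :=
      (Submodule.mem_span_range_iff_exists_fun Rᵐᵒᵖ).1 (hs ▸ Submodule.mem_top : m ∈ _)
    refine ⟨fun a => (c a).unop • q, ?_⟩
    simp only [← BalTensor.tmulHom_apply, map_sum, AddMonoidHom.finsetSum_apply]
    exact Finset.sum_congr rfl fun a _ => (BalTensor.smul_tmul R (s a) (c a).unop q).symm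
  | add x y hx hy =>
    obtain ⟨q, rfl⟩ := hx
    obtain ⟨q', rfl⟩ := hy
    exact ⟨q + q', by simp only [Pi.add_apply, map_add, Finset.sum_add_distrib]⟩

variable {M : Type u} [AddCommGroup M] [Module Rᵐᵒᵖ M] {I : Type u} (F : I → ModuleCat.{u} R)

theorem rho_surjective [Module.Finite Rᵐᵒᵖ M] : Function.Surjective (rho M F) := by
  intro z
  obtain ⟨n, s, hs⟩ := Module.Finite.exists_fin (R := Rᵐᵒᵖ) (M := M)
  choose q hq using fun i => BalTensor.exists_sum_tmul_eq hs (z i)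
  refine ⟨∑ a, BalTensor.tmul R (s a) fun i => q i a, ?_⟩
  ext i
  rw [map_sum, Finset.sum_apply, ← hq i]
  rfl

variable {F}

theorem rho_apply (z : BalTensor R M (∀ i, F i)) (i : I) :
    rho M F z i = BalTensor.map LinearMap.id (LinearMap.proj i) z :=
  rfl

theorem rho_rTensor {M' : Type u} [AddCommGroup M'] [Module Rᵐᵒᵖ M'] (f : M →ₗ[Rᵐᵒᵖ] M')
    (z : BalTensor R M (∀ i, F i)) (i : I) :
    rho M' F (BalTensor.rTensor _ f z) i = BalTensor.rTensor _ f (rho M F z i) := by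
  rw [rho_apply, rho_apply, BalTensor.map_map, BalTensor.map_map]
  rfl

theorem rho_map_pi_proj {J : Type u} (φ : J → I) (z : BalTensor R M (∀ i, F i)) (j : J) :
    rho M (fun j => F (φ j)) (BalTensor.map LinearMap.id
      (LinearMap.pi fun j => LinearMap.proj (φ j) : (∀ i, F i) →ₗ[R] ∀ j, F (φ j)) z) j =
      rho M F z (φ j) := by
  rw [rho_apply, BalTensor.map_map]
  rfl

theorem isMittagLeffler_iff {𝒬 : Set (ModuleCat.{u} R)} :
    IsMittagLeffler 𝒬 M ↔ ∀ (I : Type u) (F : I → ModuleCat.{u} R), (∀ i, F i ∈ 𝒬) →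
      ∀ z : BalTensor R M (∀ i, F i), (∀ i, rho M F z i = 0) → z = 0 := by
  simp only [IsMittagLeffler, injective_iff_map_eq_zero, funext_iff, Pi.zero_apply]

end Rho

section ProductClosure

variable {R : Type u} [Ring R] {𝒬 : Set (ModuleCat.{u} R)}

/-- The modules isomorphic to a product of modules from `𝒬`. A submodule that stays pure for these
inherits the `𝒬`-Mittag-Leffler property. -/
def productClosure (𝒬 : Set (ModuleCat.{u} R)) : Set (ModuleCat.{u} R) :=
  {P | ∃ (J : Type u) (G : J → ModuleCat.{u} R), (∀ j, G j ∈ 𝒬) ∧ Nonempty (P ≃ₗ[R] ∀ j, G j)}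

theorem pi_mem_productClosure {J : Type u} {G : J → ModuleCat.{u} R} (hG : ∀ j, G j ∈ 𝒬) :
    ModuleCat.of R (∀ j, G j) ∈ productClosure 𝒬 :=
  ⟨J, G, hG, ⟨LinearEquiv.refl R _⟩⟩

theorem subset_productClosure : 𝒬 ⊆ productClosure 𝒬 := fun Q hQ =>
  ⟨PUnit, fun _ => Q, fun _ => hQ, ⟨(LinearEquiv.funUnique PUnit R Q).symm⟩⟩

theorem IsMittagLeffler.productClosure {M : Type u} [AddCommGroup M] [Module Rᵐᵒᵖ M]
    (hM : IsMittagLeffler 𝒬 M) : IsMittagLeffler (productClosure 𝒬) M := by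
  refine isMittagLeffler_iff.2 fun I F hF z hz => ?_
  choose J G hG e using hF
  let flatten : (∀ i, F i) ≃ₗ[R] ∀ x : Σ i, J i, G x.1 x.2 :=
    LinearEquiv.piCongrRight (fun i => (e i).some) ≪≫ₗ
      (LinearEquiv.piCurry R fun i j => G i j).symm
  refine BalTensor.map_equiv_injective (LinearEquiv.refl Rᵐᵒᵖ M) flatten ?_
  rw [map_zero]
  refine isMittagLeffler_iff.1 hM (Σ i, J i) (fun x => G x.1 x.2) (fun x => hG x.1 x.2) _
    fun ⟨i, j⟩ => ?_
  calc rho M _ (BalTensor.map LinearMap.id flatten.toLinearMap z) ⟨i, j⟩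
      = BalTensor.map LinearMap.id (LinearMap.proj j ∘ₗ (e i).some.toLinearMap) (rho M F z i) := by
        rw [rho_apply, rho_apply, BalTensor.map_map, BalTensor.map_map]
        rfl
    _ = 0 := by rw [hz i, map_zero]

end ProductClosure

theorem iSup_fg_eq_top (A : Type*) (M : Type*) [Semiring A] [AddCommMonoid M] [Module A M] :
    ⨆ L : {L : Submodule A M // L.FG}, (L : Submodule A M) = ⊤ :=
  eq_top_iff.2 fun m _ => Submodule.mem_iSup_of_mem ⟨_, Submodule.fg_span_singleton m⟩
    (Submodule.mem_span_singleton_self m)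

section Purity

variable {R : Type u} [Ring R]

/-- The submodule `N` of `M` is pure with respect to `𝒬`: `N ⊗_R Q` embeds into `M ⊗_R Q` for all
`Q ∈ 𝒬`. -/
def IsTensorPure {M : Type v} [AddCommGroup M] [Module Rᵐᵒᵖ M] (𝒬 : Set (ModuleCat.{w} R))
    (N : Submodule Rᵐᵒᵖ M) : Prop :=
  ∀ Q ∈ 𝒬, Function.Injective (BalTensor.rTensor Q N.subtype)

/-- The homomorphism `g` dominates `f` on `𝒬` (Raynaud–Gruson): `g ⊗_R Q` kills whatever `f ⊗_R Q`
kills, for all `Q ∈ 𝒬`. -/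
def Dominates {M M₁ M₂ : Type v} [AddCommGroup M] [Module Rᵐᵒᵖ M] [AddCommGroup M₁]
    [Module Rᵐᵒᵖ M₁] [AddCommGroup M₂] [Module Rᵐᵒᵖ M₂] (𝒬 : Set (ModuleCat.{w} R))
    (g : M →ₗ[Rᵐᵒᵖ] M₂) (f : M →ₗ[Rᵐᵒᵖ] M₁) : Prop :=
  ∀ Q ∈ 𝒬, ∀ z : BalTensor R M Q, BalTensor.rTensor Q f z = 0 → BalTensor.rTensor Q g z = 0

section

variable {M : Type v} [AddCommGroup M] [Module Rᵐᵒᵖ M] {𝒬 : Set (ModuleCat.{w} R)}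
  {N : Submodule Rᵐᵒᵖ M}

theorem IsTensorPure.mono {𝒬' : Set (ModuleCat.{w} R)} (hN : IsTensorPure 𝒬' N) (h : 𝒬 ⊆ 𝒬') :
    IsTensorPure 𝒬 N :=
  fun Q hQ => hN Q (h hQ)

theorem IsTensorPure.eq_zero (hN : IsTensorPure 𝒬 N) {Q : ModuleCat.{w} R} (hQ : Q ∈ 𝒬)
    {z : BalTensor R N Q} (hz : BalTensor.rTensor Q N.subtype z = 0) : z = 0 :=
  (injective_iff_map_eq_zero _).1 (hN Q hQ) z hz

theorem Dominates.inclusion_mono {N₁ N₂ N₃ : Submodule Rᵐᵒᵖ M} {h₁₂ : N₁ ≤ N₂} (h₂₃ : N₂ ≤ N₃)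
    (h : Dominates 𝒬 (Submodule.inclusion h₁₂) N₁.subtype) :
    Dominates 𝒬 (Submodule.inclusion (h₁₂.trans h₂₃)) N₁.subtype := fun Q hQ z hz => by
  rw [← BalTensor.rTensor_inclusion_inclusion h₁₂ h₂₃, h Q hQ z hz, map_zero]

theorem isTensorPure_iSup {ι : Type*} [Preorder ι] [IsDirectedOrder ι] [Nonempty ι]
    {N : ι → Submodule Rᵐᵒᵖ M} (hN : Monotone N)
    (h : ∀ i, ∃ (j : ι) (hij : i ≤ j),
      Dominates 𝒬 (Submodule.inclusion (hN hij)) (N i).subtype) :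
    IsTensorPure 𝒬 (⨆ i, N i) := by
  refine fun Q hQ => (injective_iff_map_eq_zero _).2 fun z hz => ?_
  obtain ⟨i, y, rfl⟩ := BalTensor.exists_rTensor_inclusion_eq hN z
  rw [BalTensor.rTensor_subtype_inclusion] at hz
  obtain ⟨j, hij, hdom⟩ := h i
  rw [← BalTensor.rTensor_inclusion_inclusion (hN hij) (le_iSup N j), hdom Q hQ y hz, map_zero]

theorem IsTensorPure.iSup {ι : Type*} [Preorder ι] [IsDirectedOrder ι] [Nonempty ι]
    {N : ι → Submodule Rᵐᵒᵖ M} (hN : Monotone N) (h : ∀ i, IsTensorPure 𝒬 (N i)) :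
    IsTensorPure 𝒬 (⨆ i, N i) :=
  isTensorPure_iSup hN fun i => ⟨i, le_rfl, fun Q hQ z hz => by
    rw [(h i).eq_zero hQ hz, map_zero]⟩

end

variable {M : Type u} [AddCommGroup M] [Module Rᵐᵒᵖ M] {𝒬 : Set (ModuleCat.{u} R)}
  {N : Submodule Rᵐᵒᵖ M}

theorem IsTensorPure.isMittagLeffler (hN : IsTensorPure (productClosure 𝒬) N)
    (hM : IsMittagLeffler 𝒬 M) : IsMittagLeffler 𝒬 N := by
  refine isMittagLeffler_iff.2 fun I F hF z hz => ?_
  refine hN.eq_zero (pi_mem_productClosure hF) (isMittagLeffler_iff.1 hM I F hF _ fun i => ?_)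
  exact (rho_rTensor N.subtype z i).trans (by rw [hz i, map_zero])

theorem isMittagLeffler_of_exists_isTensorPure
    (h : ∀ X : Set M, X.Finite → ∃ N : Submodule Rᵐᵒᵖ M,
      X ⊆ N ∧ IsMittagLeffler 𝒬 N ∧ IsTensorPure 𝒬 N) : IsMittagLeffler 𝒬 M := by
  refine isMittagLeffler_iff.2 fun I F hF z hz => ?_
  obtain ⟨⟨L, hL⟩, y, rfl⟩ := BalTensor.exists_rTensor_subtype_eq
    (N := fun L : {L : Submodule Rᵐᵒᵖ M // L.FG} => (L : Submodule Rᵐᵒᵖ M))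
    (fun _ _ h => h) (iSup_fg_eq_top Rᵐᵒᵖ M) z
  obtain ⟨X, rfl⟩ := hL
  obtain ⟨N, hXN, hN, hpure⟩ := h X X.finite_toSet
  have hle := Submodule.span_le.2 hXN
  rw [← BalTensor.rTensor_subtype_inclusion hle, isMittagLeffler_iff.1 hN I F hF
    (BalTensor.rTensor _ (Submodule.inclusion hle) y) fun i => ?_, map_zero]
  refine hpure.eq_zero (hF i) ?_
  rw [← rho_rTensor, BalTensor.rTensor_subtype_inclusion]
  exact hz i

theorem IsMittagLeffler.exists_fg_dominates (hM : IsMittagLeffler 𝒬 M) {L : Submodule Rᵐᵒᵖ M}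
    (hL : L.FG) : ∃ (L' : Submodule Rᵐᵒᵖ M) (h : L ≤ L'), L'.FG ∧
      Dominates 𝒬 (Submodule.inclusion h) L.subtype := by
  by_contra! hcon
  let I := {L' : Submodule Rᵐᵒᵖ M // L'.FG ∧ L ≤ L'}
  have hbad (L' : I) : ∃ Q ∈ 𝒬, ∃ y : BalTensor R L Q,
      BalTensor.rTensor Q L.subtype y = 0 ∧
        BalTensor.rTensor Q (Submodule.inclusion L'.2.2) y ≠ 0 := by
    simpa only [Dominates, not_forall, exists_prop] using hcon L' L'.2.2 L'.2.1
  choose Q hQ y hy hy' using hbad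
  have : Module.Finite Rᵐᵒᵖ L := Module.Finite.iff_fg.2 hL
  obtain ⟨w, hw⟩ := rho_surjective (M := L) Q y
  have hwM : BalTensor.rTensor _ L.subtype w = 0 :=
    isMittagLeffler_iff.1 hM I Q hQ _ fun L' => by rw [rho_rTensor, hw, hy]
  obtain ⟨⟨L', hL'⟩, hle, hwL'⟩ :=
    BalTensor.exists_rTensor_inclusion_eq_zero_of_rTensor_subtype_eq_zero
      (N := fun L : {L : Submodule Rᵐᵒᵖ M // L.FG} => (L : Submodule Rᵐᵒᵖ M))
      (fun _ _ h => h) (iSup_fg_eq_top Rᵐᵒᵖ M) (i := ⟨L, hL⟩) hwM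
  refine hy' ⟨L', hL', hle⟩ ?_
  rw [← hw, ← rho_rTensor]
  exact congrFun ((congrArg (rho L' Q) hwL').trans (map_zero _)) _

end Purity

section CountablyGenerated

variable {A : Type u} [Ring A] {M : Type v} [AddCommGroup M] [Module A M]

theorem countablyGenerated_iff_exists_span_eq {N : Submodule A M} :
    CountablyGenerated A N ↔ ∃ S : Set M, S.Countable ∧ Submodule.span A S = N := by
  constructor
  · rintro ⟨S, hS, hspan⟩
    refine ⟨N.subtype '' S, hS.image _, ?_⟩
    rw [Submodule.span_image, hspan, Submodule.map_subtype_top]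
  · rintro ⟨S, hS, rfl⟩
    exact ⟨_, hS.preimage Subtype.val_injective, Submodule.span_span_coe_preimage⟩

theorem CountablyGenerated.iSup {ι : Type*} [Countable ι] {N : ι → Submodule A M}
    (hN : ∀ i, CountablyGenerated A (N i)) : CountablyGenerated A (⨆ i, N i : Submodule A M) := by
  choose S hS hspan using fun i => countablyGenerated_iff_exists_span_eq.1 (hN i)
  refine countablyGenerated_iff_exists_span_eq.2 ⟨⋃ i, S i, Set.countable_iUnion hS, ?_⟩
  rw [Submodule.span_iUnion]
  exact iSup_congr hspan

theorem countablyGenerated_of_fg {N : Submodule A M} (hN : N.FG) : CountablyGenerated A N := by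
  obtain ⟨S, hS⟩ := hN
  exact countablyGenerated_iff_exists_span_eq.2 ⟨S, S.countable_toSet, hS⟩

end CountablyGenerated

section DenseSystem

variable {R : Type u} [Ring R] {M : Type u} [AddCommGroup M] [Module Rᵐᵒᵖ M]
  {𝒬 : Set (ModuleCat.{u} R)}

theorem IsMittagLeffler.exists_isTensorPure (hM : IsMittagLeffler 𝒬 M) {X : Set M}
    (hX : X.Countable) : ∃ N : Submodule Rᵐᵒᵖ M,
      X ⊆ N ∧ CountablyGenerated Rᵐᵒᵖ N ∧ IsTensorPure 𝒬 N := by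
  obtain ⟨x, hx⟩ := Set.countable_iff_exists_subset_range.1 hX
  choose dom le_dom dom_fg dominates using fun L : {L : Submodule Rᵐᵒᵖ M // L.FG} =>
    hM.exists_fg_dominates L.2
  let L : ℕ → {L : Submodule Rᵐᵒᵖ M // L.FG} := Nat.rec ⟨⊥, Submodule.fg_bot⟩ fun n L =>
    ⟨dom L ⊔ Submodule.span Rᵐᵒᵖ {x n}, (dom_fg L).sup (Submodule.fg_span_singleton _)⟩
  have dom_le (n : ℕ) : dom (L n) ≤ L (n + 1) := le_sup_left
  have hL : Monotone fun n => (L n).1 :=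
    monotone_nat_of_le_succ fun n => (le_dom (L n)).trans (dom_le n)
  refine ⟨⨆ n, (L n).1, fun m hm => ?_,
    CountablyGenerated.iSup fun n => countablyGenerated_of_fg (L n).2,
    isTensorPure_iSup (N := fun n => (L n).1) hL fun n =>
      ⟨n + 1, n.le_succ, (dominates (L n)).inclusion_mono (dom_le n)⟩⟩
  obtain ⟨n, rfl⟩ := hx hm
  exact Submodule.mem_iSup_of_mem (n + 1)
    ((le_sup_right : _ ≤ (L (n + 1)).1) (Submodule.mem_span_singleton_self _))

theorem IsMittagLeffler.isDenseSystem_isTensorPure (hM : IsMittagLeffler 𝒬 M) :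
    IsDenseSystem (Cardinal.aleph 1)
      {N : Submodule Rᵐᵒᵖ M | CountablyGenerated Rᵐᵒᵖ N ∧ IsTensorPure 𝒬 N} where
  directed := by
    rintro N ⟨hN, -⟩ N' ⟨hN', -⟩
    obtain ⟨S, hS, rfl⟩ := countablyGenerated_iff_exists_span_eq.1 hN
    obtain ⟨S', hS', rfl⟩ := countablyGenerated_iff_exists_span_eq.1 hN'
    obtain ⟨P, hSP, hP⟩ := hM.exists_isTensorPure (hS.union hS')
    exact ⟨P, hP, Submodule.span_le.2 (Set.subset_union_left.trans hSP),
      Submodule.span_le.2 (Set.subset_union_right.trans hSP)⟩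
  chain_closed ι _ _ _ hι N hN hNC := by
    have : Countable ι := Cardinal.mk_le_aleph0_iff.1 (Cardinal.lt_aleph_one_iff.1 hι)
    exact ⟨CountablyGenerated.iSup fun i => (hNC i).1, IsTensorPure.iSup hN fun i => (hNC i).2⟩
  exists_le X hX := by
    obtain ⟨N, hXN, hN⟩ := hM.exists_isTensorPure
      (Cardinal.le_aleph0_iff_set_countable.1 (Cardinal.lt_aleph_one_iff.1 hX))
    exact ⟨N, hN, hXN⟩

theorem IsDenseSystem.exists_seq {A : Type*} [Ring A] {M : Type v} [AddCommGroup M] [Module A M]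
    {C : Set (Submodule A M)} (hC : IsDenseSystem (Cardinal.aleph 1) C)
    {r : Submodule A M → Submodule A M → Prop} {N₀ : Submodule A M} (hN₀ : N₀ ∈ C)
    (hr : ∀ N ∈ C, N₀ ≤ N → ∃ N' ∈ C, N ≤ N' ∧ r N N') : ∃ s : ℕ → Submodule A M,
      Monotone s ∧ s 0 = N₀ ∧ (∀ n, r (s n) (s (n + 1))) ∧ ⨆ n, s n ∈ C := by
  choose next next_mem le_next r_next using fun N : {N // N ∈ C ∧ N₀ ≤ N} => hr N N.2.1 N.2.2
  let s : ℕ → {N // N ∈ C ∧ N₀ ≤ N} := Nat.rec ⟨N₀, hN₀, le_rfl⟩ fun _ N =>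
    ⟨next N, next_mem N, N.2.2.trans (le_next N)⟩
  have hs : Monotone fun n => (s n).1 := monotone_nat_of_le_succ fun n => le_next (s n)
  refine ⟨fun n => (s n).1, hs, rfl, fun n => r_next (s n), ?_⟩
  have hcard : Cardinal.mk (ULift.{v} ℕ) < Cardinal.aleph 1 :=
    Cardinal.lt_aleph_one_iff.2 Cardinal.mk_le_aleph0
  have hmem := hC.chain_closed (ULift.{v} ℕ) hcard (fun n => (s n.down).1)
    (fun _ _ h => hs h) fun n => (s n.down).2.1
  exact (Equiv.ulift.iSup_comp (g := fun n => (s n).1)) ▸ hmem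

theorem IsDenseSystem.nonempty {A : Type*} [Ring A] {M : Type v} [AddCommGroup M] [Module A M]
    {κ : Cardinal.{v}} (hκ : 0 < κ) {C : Set (Submodule A M)} (hC : IsDenseSystem κ C) :
    C.Nonempty := by
  obtain ⟨N, hN, -⟩ := hC.exists_le ∅ (by rwa [Cardinal.mk_eq_zero])
  exact ⟨N, hN⟩

theorem IsDenseSystem.iSup_eq_top {A : Type*} [Ring A] {M : Type v} [AddCommGroup M] [Module A M]
    {κ : Cardinal.{v}} (hκ : 1 < κ) {C : Set (Submodule A M)} (hC : IsDenseSystem κ C) :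
    ⨆ N : C, (N : Submodule A M) = ⊤ := by
  refine eq_top_iff.2 fun m _ => ?_
  obtain ⟨N, hN, hmN⟩ := hC.exists_le {m} (by rwa [Cardinal.mk_singleton])
  exact Submodule.mem_iSup_of_mem ⟨N, hN⟩ (hmN rfl)

theorem IsMittagLeffler.exists_rTensor_rho_eq_zero {ι : Type*} [Preorder ι] [IsDirectedOrder ι]
    {N : ι → Submodule Rᵐᵒᵖ M} (hN : Monotone N)
    (hML : IsMittagLeffler 𝒬 (⨆ i, N i : Submodule Rᵐᵒᵖ M)) {K : Type u} {F : K → ModuleCat.{u} R}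
    (hF : ∀ k, F k ∈ 𝒬) {i : ι} {y : BalTensor R (N i) (∀ k, F k)}
    (hy : ∀ k, BalTensor.rTensor _ (Submodule.inclusion (le_iSup N i)) (rho (N i) F y k) = 0) :
    ∃ (j : ι) (hij : i ≤ j), ∀ k,
      BalTensor.rTensor _ (Submodule.inclusion (hN hij)) (rho (N i) F y k) = 0 := by
  have hyU := isMittagLeffler_iff.1 hML K F hF _ fun k => (rho_rTensor _ y k).trans (hy k)
  obtain ⟨j, hij, hj⟩ := BalTensor.exists_rTensor_inclusion_eq_zero hN hyU
  exact ⟨j, hij, fun k => by rw [← rho_rTensor, hj, map_zero, Pi.zero_apply]⟩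

theorem IsDenseSystem.exists_rTensor_rho_eq_zero {κ : Cardinal.{u}} (hκ : 1 < κ)
    {C : Set (Submodule Rᵐᵒᵖ M)} (hC : IsDenseSystem κ C) {N₀ N : Submodule Rᵐᵒᵖ M} (hN : N ∈ C)
    (hML : IsMittagLeffler 𝒬 N) (hle : N₀ ≤ N) {I : Type u} {F : I → ModuleCat.{u} R}
    (hF : ∀ i, F i ∈ 𝒬) {y : BalTensor R N₀ (∀ i, F i)}
    (hy : BalTensor.rTensor (∀ i, F i) N₀.subtype y ≠ 0)
    (hrho : ∀ i, rho M F (BalTensor.rTensor _ N₀.subtype y) i = 0) :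
    ∃ N' ∈ C, ∃ (hle' : N ≤ N') (i : I),
      BalTensor.rTensor _ (Submodule.inclusion hle) (rho N₀ F y i) ≠ 0 ∧
      BalTensor.rTensor _ (Submodule.inclusion (hle.trans hle')) (rho N₀ F y i) = 0 := by
  have : IsDirectedOrder C := directedOn_iff_isDirectedOrder.1 hC.directed
  obtain ⟨i, hi⟩ : ∃ i, BalTensor.rTensor _ (Submodule.inclusion hle) (rho N₀ F y i) ≠ 0 := by
    by_contra! hzero
    refine hy ?_
    rw [← BalTensor.rTensor_subtype_inclusion hle, isMittagLeffler_iff.1 hML I F hF _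
      fun i => (rho_rTensor _ y i).trans (hzero i), map_zero]
  have hiM : BalTensor.rTensor _ N.subtype
      (BalTensor.rTensor _ (Submodule.inclusion hle) (rho N₀ F y i)) = 0 := by
    rw [BalTensor.rTensor_subtype_inclusion, ← rho_rTensor, hrho]
  obtain ⟨⟨N', hN'⟩, hle', hiN'⟩ :=
    BalTensor.exists_rTensor_inclusion_eq_zero_of_rTensor_subtype_eq_zero
      (N := fun N : C => (N : Submodule Rᵐᵒᵖ M)) (i := ⟨N, hN⟩) (fun _ _ h => h)
      (hC.iSup_eq_top hκ) hiM
  exact ⟨N', hN', hle', i, hi, by rwa [BalTensor.rTensor_inclusion_inclusion] at hiN'⟩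

theorem IsDenseSystem.isMittagLeffler {C : Set (Submodule Rᵐᵒᵖ M)}
    (hC : IsDenseSystem (Cardinal.aleph 1) C) (hML : ∀ N ∈ C, IsMittagLeffler 𝒬 N) :
    IsMittagLeffler 𝒬 M := by
  have hκ : 1 < Cardinal.aleph 1 := Cardinal.one_lt_aleph0.trans Cardinal.aleph0_lt_aleph_one
  have : IsDirectedOrder C := directedOn_iff_isDirectedOrder.1 hC.directed
  have : Nonempty C := (hC.nonempty (zero_lt_one.trans hκ)).to_subtype
  refine isMittagLeffler_iff.2 fun I F hF z hz => ?_
  obtain ⟨⟨N₀, hN₀⟩, y, rfl⟩ := BalTensor.exists_rTensor_subtype_eq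
    (N := fun N : C => (N : Submodule Rᵐᵒᵖ M)) (fun _ _ h => h) (hC.iSup_eq_top hκ) z
  by_contra hy
  obtain ⟨s, hs, rfl, hr, hU⟩ := hC.exists_seq (r := fun N N' => ∃ (hle : N₀ ≤ N) (hle' : N ≤ N')
      (i : I), BalTensor.rTensor _ (Submodule.inclusion hle) (rho N₀ F y i) ≠ 0 ∧
        BalTensor.rTensor _ (Submodule.inclusion (hle.trans hle')) (rho N₀ F y i) = 0)
    hN₀ fun N hN hle => by
      obtain ⟨N', hN', hle', hi⟩ := hC.exists_rTensor_rho_eq_zero hκ hN (hML N hN) hle hF hy hz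
      exact ⟨N', hN', hle', hle, hle', hi⟩
  choose hle hle' i hne hzero using hr
  let φ (n : ULift.{u} ℕ) : I := i n.down
  obtain ⟨n, _, hn⟩ := (hML _ hU).exists_rTensor_rho_eq_zero hs (fun k => hF (φ k))
    (y := BalTensor.map LinearMap.id (LinearMap.pi fun k => LinearMap.proj (φ k)) y) fun k => by
      rw [rho_map_pi_proj φ, ← BalTensor.rTensor_inclusion_inclusion (hs (Nat.zero_le _))
        (le_iSup s (k.down + 1)), hzero k.down, map_zero]
  exact hne n ((congrArg _ (rho_map_pi_proj φ y ⟨n⟩)).symm.trans (hn ⟨n⟩))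

end DenseSystem

section CountablyPresented

variable {R : Type u} [Ring R] {M : Type u} [AddCommGroup M] [Module Rᵐᵒᵖ M]
  {𝒬 : Set (ModuleCat.{u} R)}

theorem IsMittagLeffler.exists_fg_ker (hR : ModuleCat.of R R ∈ 𝒬) (hM : IsMittagLeffler 𝒬 M)
    {A : Type u} [AddCommGroup A] [Module Rᵐᵒᵖ A] {p : A →ₗ[Rᵐᵒᵖ] M} (hp : Function.Surjective p)
    {B : Submodule Rᵐᵒᵖ A} (hB : B.FG) :
    ∃ L : Submodule Rᵐᵒᵖ (LinearMap.ker p), L.FG ∧ B.comap (LinearMap.ker p).subtype ≤ L := by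
  let K := B.comap (LinearMap.ker p).subtype
  let F (_ : K) : ModuleCat.{u} R := ModuleCat.of R R
  have : Module.Finite Rᵐᵒᵖ B := Module.Finite.iff_fg.2 hB
  obtain ⟨w, hw⟩ := rho_surjective (M := B) F fun k => BalTensor.tmul R ⟨k.1, k.2⟩ (1 : R)
  have hwA (k : K) : rho A F (BalTensor.rTensor _ B.subtype w) k =
      BalTensor.tmul R (k.1 : A) (1 : R) := by
    rw [rho_rTensor, hw]
    rfl
  have hwM : BalTensor.rTensor _ p (BalTensor.rTensor _ B.subtype w) = 0 := by
    refine isMittagLeffler_iff.1 hM K F (fun _ => hR) _ fun k => ?_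
    rw [rho_rTensor, hwA, BalTensor.map_tmul, LinearMap.mem_ker.1 k.1.2, ← BalTensor.tmulHom_apply,
      map_zero, AddMonoidHom.zero_apply]
  obtain ⟨v, hv⟩ := BalTensor.exists_rTensor_ker_subtype_eq hp hwM
  obtain ⟨⟨L, hL⟩, x, rfl⟩ := BalTensor.exists_rTensor_subtype_eq
    (N := fun L : {L : Submodule Rᵐᵒᵖ (LinearMap.ker p) // L.FG} => L.1)
    (fun _ _ h => h) (iSup_fg_eq_top Rᵐᵒᵖ (LinearMap.ker p)) v
  refine ⟨L, hL, fun k hk => ?_⟩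
  let l : L := BalTensor.rid (R := R) (rho L F x ⟨k, hk⟩)
  have hkl : (k : A) = l.1 := calc
    (k : A) = BalTensor.rid (BalTensor.tmul R (k : A) (1 : R)) := by
      rw [BalTensor.rid_tmul, MulOpposite.op_one, one_smul]
    _ = BalTensor.rid (R := R) (BalTensor.rTensor _ (LinearMap.ker p).subtype
          (BalTensor.rTensor _ L.subtype (rho L F x ⟨k, hk⟩))) := by
      rw [← hwA ⟨k, hk⟩, ← hv, rho_rTensor, rho_rTensor]
    _ = l.1 := (BalTensor.rid_rTensor _ _).trans (congrArg _ (BalTensor.rid_rTensor _ _))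
  exact Subtype.ext hkl ▸ l.2

theorem IsMittagLeffler.countablyGenerated_ker (hR : ModuleCat.of R R ∈ 𝒬)
    (hM : IsMittagLeffler 𝒬 M) {A : Type u} [AddCommGroup A] [Module Rᵐᵒᵖ A]
    (hA : CountablyGenerated Rᵐᵒᵖ A) {p : A →ₗ[Rᵐᵒᵖ] M} (hp : Function.Surjective p) :
    CountablyGenerated Rᵐᵒᵖ (LinearMap.ker p) := by
  obtain ⟨S, hS, hspan⟩ := hA
  have : Countable {Y : Set A // Y.Finite ∧ Y ⊆ S} :=
    (Set.countable_ofPred_finite_subset hS).to_subtype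
  choose L hL hle using fun Y : {Y : Set A // Y.Finite ∧ Y ⊆ S} =>
    hM.exists_fg_ker hR hp (Submodule.fg_span (R := Rᵐᵒᵖ) Y.2.1)
  have hsup : ⨆ Y, L Y = ⊤ := eq_top_iff.2 fun k _ => by
    obtain ⟨Y, hYS, hY⟩ := Submodule.mem_span_finite_of_mem_span
      (hspan ▸ Submodule.mem_top : (k : A) ∈ Submodule.span Rᵐᵒᵖ S)
    exact Submodule.mem_iSup_of_mem ⟨Y, Y.finite_toSet, hYS⟩ (hle _ hY)
  obtain ⟨T, hT, hTL⟩ := countablyGenerated_iff_exists_span_eq.1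
    (CountablyGenerated.iSup fun Y => countablyGenerated_of_fg (hL Y))
  exact ⟨T, hT, hTL.trans hsup⟩

theorem IsMittagLeffler.countablyPresented (hR : ModuleCat.of R R ∈ 𝒬)
    (hM : IsMittagLeffler 𝒬 M) (hgen : CountablyGenerated Rᵐᵒᵖ M) :
    CountablyPresented Rᵐᵒᵖ M := by
  obtain ⟨S, hS, hspan⟩ := hgen
  obtain ⟨x, hx⟩ := Set.countable_iff_exists_subset_range.1 hS
  have hsurj : Function.Surjective (Finsupp.linearCombination Rᵐᵒᵖ x) := by
    rw [← LinearMap.range_eq_top, Finsupp.range_linearCombination]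
    exact top_unique (hspan.ge.trans (Submodule.span_mono hx))
  have hfree : CountablyGenerated Rᵐᵒᵖ (ℕ →₀ Rᵐᵒᵖ) :=
    ⟨Set.range Finsupp.basisSingleOne, Set.countable_range _, Finsupp.basisSingleOne.span_eq⟩
  exact ⟨_, hsurj, hM.countablyGenerated_ker hR hfree hsurj⟩

end CountablyPresented

end

end RelML

theorem mainTheorem2 {R : Type u} [Ring R] (𝒬 : Set (ModuleCat.{u} R))
    (M : Type u) [AddCommGroup M] [Module Rᵐᵒᵖ M] :
    List.TFAE
      [ -- (i)
        RelML.IsMittagLeffler 𝒬 M,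
        -- (ii)
        ∀ X : Set M, X.Countable → ∃ N : Submodule Rᵐᵒᵖ M,
          X ⊆ N ∧ RelML.CountablyGenerated Rᵐᵒᵖ N ∧ RelML.IsMittagLeffler 𝒬 N ∧
          ∀ Q ∈ 𝒬, Function.Injective
            (RelML.BalTensor.map N.subtype (LinearMap.id : Q →ₗ[R] Q)),
        -- (iii)
        ∃ C : Set (Submodule Rᵐᵒᵖ M), RelML.IsDenseSystem (Cardinal.aleph 1) C ∧
          ∀ N ∈ C, RelML.CountablyGenerated Rᵐᵒᵖ N ∧ RelML.IsMittagLeffler 𝒬 N,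
        -- (iv)
        ∃ C : Set (Submodule Rᵐᵒᵖ M), RelML.IsDenseSystem (Cardinal.aleph 1) C ∧
          ∀ N ∈ C, RelML.IsMittagLeffler 𝒬 N ] ∧
    (ModuleCat.of R R ∈ 𝒬 →
      -- (i) ↔ (v)
      (RelML.IsMittagLeffler 𝒬 M ↔
        ∃ C : Set (Submodule Rᵐᵒᵖ M), RelML.IsDenseSystem (Cardinal.aleph 1) C ∧
          ∀ N ∈ C, RelML.CountablyPresented Rᵐᵒᵖ N ∧ RelML.IsMittagLeffler 𝒬 N)) := by
  have dense (hM : RelML.IsMittagLeffler 𝒬 M) := hM.productClosure.isDenseSystem_isTensorPure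
  constructor
  · tfae_have 1 → 2 := fun hM X hX => by
      obtain ⟨N, hXN, hgen, hpure⟩ := hM.productClosure.exists_isTensorPure hX
      exact ⟨N, hXN, hgen, hpure.isMittagLeffler hM, hpure.mono RelML.subset_productClosure⟩
    tfae_have 2 → 1 := fun h => RelML.isMittagLeffler_of_exists_isTensorPure fun X hX => by
      obtain ⟨N, hXN, -, hN⟩ := h X hX.countable
      exact ⟨N, hXN, hN⟩
    tfae_have 1 → 3 := fun hM =>
      ⟨_, dense hM, fun N ⟨hgen, hpure⟩ => ⟨hgen, hpure.isMittagLeffler hM⟩⟩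
    tfae_have 3 → 4 := fun ⟨C, hC, h⟩ => ⟨C, hC, fun N hN => (h N hN).2⟩
    tfae_have 4 → 1 := fun ⟨C, hC, h⟩ => hC.isMittagLeffler h
    tfae_finish
  · refine fun hR => ⟨fun hM => ⟨_, dense hM, fun N ⟨hgen, hpure⟩ => ?_⟩, ?_⟩
    · have hN := hpure.isMittagLeffler hM
      exact ⟨hN.countablyPresented hR hgen, hN⟩
    · exact fun ⟨C, hC, h⟩ => hC.isMittagLeffler fun N hN => (h N hN).2
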